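/- Let $m \ge 1$ be an integer. In the linear de-preferential attachment model with $m$ half-edges per new vertex, the initial (multi)graph $G_2$ has the two vertices $v_1, v_2$, joined by $m$ edges, and $m$ further free edges attached to one of the two vertices. For $n \ge 2$, the graph $G_{n+1}$ is obtained from $G_n$ by adding a vertex $v_{n+1}$ with half-edges $e_{n+1,1},\dots,e_{n+1,m}$, which are attached one after the other to the vertices $v_1,\dots,v_n$: for $0 \le k \le m-1$ and $1 \le j \le n$, $$P\big(e_{n+1,k+1} = \{v_j, v_{n+1}\} \,\big|\, \mathscr F_{n+1,k}\big) = \frac{1}{n-1}\left(1 - \frac{d_j(n+1,k)}{k + (2n-1)m}\right),$$ where $d_j(n+1,k)$ is the degree of $v_j$ (counting multiple and free edges) after the first $k$ half-edges of $v_{n+1}$ have been attached, and $\mathscr F_{n+1,k}$ is the $\sigma$-algebra generated by all attachments made up to that moment. Let $d_i(n) = d_i(n+1,0)$ be the degree of $v_i$ in $G_n$. Then, for every fixed $i \ge 1$, as $n \to \infty$, $$\frac{d_i(n) - m\log n}{\sqrt{m \log n}} \ \stackrel{d}{\longrightarrow}\ N(0,1).$$ -/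

import Mathlib

open MeasureTheory ProbabilityTheory Filter

namespace DePref

/-- A finite multigraph (multiple edges and loops allowed) with vertices labelled by natural
numbers. Besides ordinary edges it may carry free edges, i.e. edges attached to one vertex only,
which are recorded by the vertex they are attached to. -/
structure OpenMultigraph where
  verts : Finset ℕ
  edges : Multiset (Sym2 ℕ)
  free : Multiset ℕ

/-- The degree of a vertex: the number of edge ends and free edges attached to it
(a loop counts twice). -/
def OpenMultigraph.degree (G : OpenMultigraph) (v : ℕ) : ℕ :=
  (G.edges.bind Sym2.toMultiset).count v + G.free.count v

/-- The graph `G(n+1, k)`, that is, `G_n` together with the first `k` half-edges of the vertex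
`n + 1`. The half-edge number `q ∈ {1, …, m}` of the vertex `l ≥ 3` is joined to the vertex `a l q`.
The initial graph `G_2` has the vertices `1` and `2`, joined by `m` edges, and `m` free edges
at the vertex `r`. Meant for `n ≥ 2` and `k ≤ m`. -/
def graph (m r : ℕ) (a : ℕ → ℕ → ℕ) (n k : ℕ) : OpenMultigraph where
  verts := if k = 0 then Finset.Icc 1 n else Finset.Icc 1 (n + 1)
  edges := Multiset.replicate m s(1, 2)
    + ∑ l ∈ Finset.Icc 3 n, ∑ q ∈ Finset.Icc 1 m, {s(l, a l q)}
    + ∑ q ∈ Finset.Icc 1 k, {s(n + 1, a (n + 1) q)}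
  free := Multiset.replicate m r

/-- `d_i(n+1, k)`: the degree of the vertex `i` after the first `k` half-edges of the vertex
`n + 1` have been attached. -/
def deg (m r : ℕ) (a : ℕ → ℕ → ℕ) (i n k : ℕ) : ℕ :=
  (graph m r a n k).degree i

/-- The σ-algebra `𝓕_{n+1,k}` of the natural filtration: it is generated by all attachments made
before the half-edge number `k + 1` of the vertex `n + 1` is attached. -/
@[reducible] def history {Ω : Type*} (m : ℕ) (A : ℕ → ℕ → Ω → ℕ) (n k : ℕ) : MeasurableSpace Ω :=
  (⨆ l ∈ Finset.Icc 3 n, ⨆ q ∈ Finset.Icc 1 m, MeasurableSpace.comap (A l q) ⊤)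
    ⊔ ⨆ q ∈ Finset.Icc 1 k, MeasurableSpace.comap (A (n + 1) q) ⊤

/-- The random attachments `A` (where `A n q` is the vertex to which the half-edge number `q` of
the vertex `n` is joined) follow the linear de-preferential attachment model with `m` half-edges
per new vertex and initial free edges at the vertex `r`: sequentially, each half-edge of the
new vertex `n + 1` is joined to one of the vertices `1, …, n`, and, given the past, to the
vertex `j` with probability `(1 - d_j(n+1,k) / (k + (2n-1)m)) / (n-1)`. -/
structure IsLinearDePref {Ω : Type*} [MeasurableSpace Ω] (μ : Measure Ω) (m r : ℕ)
    (A : ℕ → ℕ → Ω → ℕ) : Prop where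
  measurable : ∀ n k : ℕ, 2 ≤ n → k < m → Measurable (A (n + 1) (k + 1))
  mem_existing : ∀ n k : ℕ, 2 ≤ n → k < m → ∀ ω, A (n + 1) (k + 1) ω ∈ Finset.Icc 1 n
  condProb : ∀ n k j : ℕ, 2 ≤ n → k < m → j ∈ Finset.Icc 1 n →
    μ[(A (n + 1) (k + 1) ⁻¹' {j}).indicator (fun _ => (1 : ℝ)) | history m A n k]
      =ᵐ[μ] fun ω => 1 / ((n : ℝ) - 1) *
        (1 - (deg m r (fun l q => A l q ω) j n k : ℝ) / ((k : ℝ) + (2 * (n : ℝ) - 1) * (m : ℝ)))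

end DePref

/-! Given the past, each half-edge of `v_{n+1}` hits `v_i` with probability `q (1 - D/T)`, where `q
= 1/(n-1)`, `D` is the current degree and `T ≥ n`. Were it not for the feedback term `D/T`, the
degree would be a sum of independent Bernoulli variables, nearly Poisson with parameter `m log n`.

This is made precise with characteristic functions. By `norm_integral_exp_step_le`, one half-edge
multiplies the characteristic function at `s` by `exp (q (e^{is} - 1))`, up to an error `|s| (q² + q
E[D]/T)`. A crude bound `E[D] ≤ C √n` (`degMean_le_mul_sqrt`) makes these errors `O(|s| n^{-3/2})`,
hence summable. As the factors are contractions, the errors telescope to `C |s|`, uniformly in time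
(`exists_norm_degCharFun_sub_le`).

At `s = t / √(m log n) → 0` this error vanishes, and what remains is the normal limit of a
standardized Poisson law (`tendsto_exp_poisson_standardized`). Lévy's continuity theorem concludes.
-/

namespace DePref

/-! ### Degrees as sums over attachments -/

/-- The number of ends at the vertex `i` of a multiset of edges, as an additive map. -/
def endCount (i : ℕ) : Multiset (Sym2 ℕ) →+ ℕ where
  toFun E := (E.bind Sym2.toMultiset).count i
  map_zero' := by simp
  map_add' := by simp

lemma endCount_singleton (i l x : ℕ) :
    endCount i {s(l, x)} = (if i = l then 1 else 0) + if i = x then 1 else 0 := by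
  have h : Sym2.toMultiset s(l, x) = {l} + {x} := rfl
  change Multiset.count i (Multiset.bind {s(l, x)} Sym2.toMultiset) = _
  rw [Multiset.singleton_bind, h, Multiset.count_add, Multiset.count_singleton,
    Multiset.count_singleton]

lemma deg_eq (m r : ℕ) (a : ℕ → ℕ → ℕ) (i n k : ℕ) :
    deg m r a i n k = endCount i (Multiset.replicate m s(1, 2))
      + ∑ l ∈ Finset.Icc 3 n, ∑ q ∈ Finset.Icc 1 m, endCount i {s(l, a l q)}
      + ∑ q ∈ Finset.Icc 1 k, endCount i {s(n + 1, a (n + 1) q)}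
      + (Multiset.replicate m r).count i := by
  change endCount i (graph m r a n k).edges + _ = _
  simp [graph, map_sum]

lemma deg_succ {m r i n : ℕ} (a : ℕ → ℕ → ℕ) (k : ℕ) (hi : i ≤ n) :
    deg m r a i n (k + 1) = deg m r a i n k + if a (n + 1) (k + 1) = i then 1 else 0 := by
  rw [deg_eq, deg_eq, Finset.sum_Icc_succ_top (by omega), endCount_singleton,
    if_neg (show i ≠ n + 1 by omega)]
  simp only [eq_comm (a := i)]
  ring

lemma deg_succ_zero {m r i n : ℕ} (a : ℕ → ℕ → ℕ) (hn : 2 ≤ n) :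
    deg m r a i (n + 1) 0 = deg m r a i n m := by
  rw [deg_eq, deg_eq, Finset.sum_Icc_succ_top (by omega)]
  simp
  ring

lemma endCount_singleton_le (i l x : ℕ) : endCount i {s(l, x)} ≤ 2 := by
  rw [endCount_singleton]
  split_ifs <;> simp

lemma exists_deg_le (m r i n k : ℕ) : ∃ B, ∀ a : ℕ → ℕ → ℕ, deg m r a i n k ≤ B := by
  refine ⟨endCount i (Multiset.replicate m s(1, 2))
      + ∑ l ∈ Finset.Icc 3 n, ∑ q ∈ Finset.Icc 1 m, 2
      + ∑ q ∈ Finset.Icc 1 k, 2 + (Multiset.replicate m r).count i, fun a => ?_⟩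
  rw [deg_eq]
  gcongr <;> exact endCount_singleton_le _ _ _

section Degree

variable {Ω : Type*}

/-- The σ-algebra is left free so as to cover both the ambient one and `history`. -/
lemma measurable_deg_of {mΩ : MeasurableSpace Ω} {m r : ℕ} {A : ℕ → ℕ → Ω → ℕ} {n k : ℕ} (i : ℕ)
    (h : ∀ l ∈ Finset.Icc 3 n, ∀ q ∈ Finset.Icc 1 m, Measurable (A l q))
    (h' : ∀ q ∈ Finset.Icc 1 k, Measurable (A (n + 1) q)) :
    Measurable fun ω => deg m r (fun l q => A l q ω) i n k := by
  simp only [deg_eq]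
  refine ((measurable_const.add ?_).add ?_).add measurable_const
  · exact Finset.measurable_fun_sum _ fun l hl => Finset.measurable_fun_sum _ fun q hq =>
      (measurable_of_countable fun x => endCount i {s(l, x)}).comp (h l hl q hq)
  · exact Finset.measurable_fun_sum _ fun q hq =>
      (measurable_of_countable fun x => endCount i {s(n + 1, x)}).comp (h' q hq)

lemma measurable_deg_history (m r : ℕ) (A : ℕ → ℕ → Ω → ℕ) (i n k : ℕ) :
    Measurable[history m A n k] fun ω => deg m r (fun l q => A l q ω) i n k := by
  refine @measurable_deg_of _ (history m A n k) _ _ _ _ _ _ (fun l hl q hq => ?_) fun q hq => ?_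
  · refine measurable_iff_comap_le.2 (le_trans ?_ le_sup_left)
    exact le_iSup₂_of_le l hl (le_iSup₂_of_le q hq le_rfl)
  · refine measurable_iff_comap_le.2 (le_trans ?_ le_sup_right)
    exact le_iSup₂_of_le q hq le_rfl

variable [mΩ : MeasurableSpace Ω] {μ : Measure Ω} {m r : ℕ} {A : ℕ → ℕ → Ω → ℕ}

namespace IsLinearDePref

lemma measurable_attachment (hA : IsLinearDePref μ m r A) {l q : ℕ} (hl : 3 ≤ l) (hq : 1 ≤ q)
    (hqm : q ≤ m) : Measurable (A l q) := by
  have := hA.measurable (l - 1) (q - 1) (by omega) (by omega)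
  rwa [Nat.sub_add_cancel (by omega), Nat.sub_add_cancel hq] at this

lemma measurable_deg (hA : IsLinearDePref μ m r A) (i : ℕ) {n k : ℕ} (hn : 2 ≤ n) (hk : k ≤ m) :
    Measurable fun ω => deg m r (fun l q => A l q ω) i n k := by
  refine measurable_deg_of i (fun l hl q hq => ?_) fun q hq => ?_
  all_goals
    simp only [Finset.mem_Icc] at *
    exact hA.measurable_attachment (by omega) (by omega) (by omega)

lemma measurable_deg_zero (hA : IsLinearDePref μ m r A) (i n : ℕ) :
    Measurable fun ω => deg m r (fun l q => A l q ω) i n 0 := by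
  refine measurable_deg_of i (fun l hl q hq => ?_) (by simp)
  simp only [Finset.mem_Icc] at *
  exact hA.measurable_attachment (by omega) (by omega) (by omega)

lemma history_le (hA : IsLinearDePref μ m r A) {n k : ℕ} (hn : 2 ≤ n) (hk : k ≤ m) :
    history m A n k ≤ mΩ := by
  refine sup_le (iSup₂_le fun l hl => iSup₂_le fun q hq => ?_) (iSup₂_le fun q hq => ?_)
  all_goals
    simp only [Finset.mem_Icc] at *
    exact (hA.measurable_attachment (by omega) (by omega) (by omega)).comap_le

lemma integrable_deg [IsFiniteMeasure μ] (hA : IsLinearDePref μ m r A) (i : ℕ) {n k : ℕ}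
    (hn : 2 ≤ n) (hk : k ≤ m) :
    Integrable (fun ω => (deg m r (fun l q => A l q ω) i n k : ℝ)) μ := by
  obtain ⟨B, hB⟩ := exists_deg_le m r i n k
  refine Integrable.of_bound
    (measurable_from_nat.comp (hA.measurable_deg i hn hk)).aestronglyMeasurable B
    (ae_of_all _ fun ω => ?_)
  simpa using hB _

end IsLinearDePref

end Degree

/-! ### One half-edge: comparison with a Poisson factor -/

lemma norm_exp_mul_I_sub_one_le (s : ℝ) : ‖Complex.exp (s * Complex.I) - 1‖ ≤ |s| := by
  have := Real.norm_exp_I_mul_ofReal_sub_one_le (x := s)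
  rwa [mul_comm, Real.norm_eq_abs] at this

lemma re_exp_mul_I_sub_one_nonpos (s : ℝ) : (Complex.exp (s * Complex.I) - 1).re ≤ 0 := by
  simpa [Complex.exp_ofReal_mul_I_re] using Real.cos_le_one s

section Step

variable {Ω : Type*} {m₀ mΩ : MeasurableSpace Ω} {μ : Measure Ω} [IsProbabilityMeasure μ]
  {D : Ω → ℕ} {S : Set Ω} {q T : ℝ}

lemma integral_indicator_le_of_condExp (hm : m₀ ≤ mΩ)
    (hint : Integrable (fun ω => (D ω : ℝ)) μ) (hq : 0 ≤ q) (hT : 0 < T)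
    (hcond : μ[S.indicator (fun _ => (1 : ℝ)) | m₀] =ᵐ[μ] fun ω => q * (1 - D ω / T)) :
    ∫ ω, S.indicator (fun _ => (1 : ℝ)) ω ∂μ ≤ q := by
  rw [← integral_condExp hm, integral_congr_ae hcond]
  calc ∫ ω, q * (1 - D ω / T) ∂μ ≤ ∫ _, q ∂μ := by
        refine integral_mono (((integrable_const _).sub (hint.div_const T)).const_mul q)
          (integrable_const _) fun ω => ?_
        have : 0 ≤ (D ω : ℝ) / T := by positivity
        dsimp only
        nlinarith
    _ = q := by simp

/-- Adding to an `ℕ`-valued variable `D` a Bernoulli variable of conditional success probability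
`q * (1 - D / T)` multiplies its characteristic function, up to a small error, by that of a
Poisson variable with parameter `q`. -/
lemma norm_integral_exp_step_le (hm : m₀ ≤ mΩ) (hD : Measurable[m₀] D)
    (hint : Integrable (fun ω => (D ω : ℝ)) μ) (hS : MeasurableSet S)
    (hq : 0 ≤ q) (hq1 : q ≤ 1) (hT : 0 < T)
    (hcond : μ[S.indicator (fun _ => (1 : ℝ)) | m₀] =ᵐ[μ] fun ω => q * (1 - D ω / T))
    {D' : Ω → ℕ} (hD' : ∀ ω, (D' ω : ℝ) = D ω + S.indicator (fun _ => (1 : ℝ)) ω)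
    {s : ℝ} (hs : |s| ≤ 1) :
    ‖∫ ω, Complex.exp (s * D' ω * Complex.I) ∂μ
      - Complex.exp (q * (Complex.exp (s * Complex.I) - 1))
        * ∫ ω, Complex.exp (s * D ω * Complex.I) ∂μ‖
      ≤ |s| * (q ^ 2 + q * (∫ ω, (D ω : ℝ) ∂μ) / T) := by
  set w := Complex.exp (s * Complex.I) - 1 with hw
  have hws : ‖w‖ ≤ |s| := norm_exp_mul_I_sub_one_le s
  set e : Ω → ℂ := fun ω => Complex.exp (s * D ω * Complex.I) with he
  set χ : Ω → ℝ := S.indicator (fun _ => (1 : ℝ)) with hχ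
  have hemeas : StronglyMeasurable[m₀] e :=
    (Measurable.comp (g := fun d : ℕ => Complex.exp (s * d * Complex.I))
      measurable_from_nat hD).stronglyMeasurable
  have henorm : ∀ ω, ‖e ω‖ = 1 := fun ω => by
    rw [he]
    have := Complex.norm_exp_ofReal_mul_I (s * D ω)
    push_cast at this
    exact this
  have heint : Integrable e μ :=
    .of_bound (hemeas.mono hm).aestronglyMeasurable 1 (ae_of_all _ fun ω => (henorm ω).le)
  have hχint : Integrable χ μ := (integrable_const (1 : ℝ)).indicator hS
  have hχe : Integrable (χ • e) μ := by
    refine heint.mono (hχint.aestronglyMeasurable.smul heint.aestronglyMeasurable)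
      (ae_of_all _ fun ω => ?_)
    by_cases h : ω ∈ S <;> simp [hχ, h]
  have hDe : Integrable (fun ω => (D ω : ℝ) • e ω) μ := by
    refine hint.mono (hint.aestronglyMeasurable.smul heint.aestronglyMeasurable)
      (ae_of_all _ fun ω => ?_)
    simp [henorm]
  -- `e` is `m₀`-measurable, so it can be pulled out of the conditional expectation of `χ • e`.
  have hpull : ∫ ω, χ ω • e ω ∂μ
      = q * ∫ ω, e ω ∂μ - (q / T : ℝ) * ∫ ω, (D ω : ℝ) • e ω ∂μ := by
    have h1 := condExp_smul_of_aestronglyMeasurable_right hχint hχe hemeas.aestronglyMeasurable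
    calc ∫ ω, χ ω • e ω ∂μ = ∫ ω, (μ[χ • e | m₀]) ω ∂μ := (integral_condExp hm).symm
      _ = ∫ ω, ((q : ℂ) * e ω - (q / T : ℝ) * ((D ω : ℝ) • e ω)) ∂μ := by
          refine integral_congr_ae ?_
          filter_upwards [h1, hcond] with ω h1 h2
          rw [h1, Pi.smul_apply', h2]
          simp only [Complex.real_smul]
          push_cast
          ring
      _ = _ := by
          rw [integral_sub (heint.const_mul _) (hDe.const_mul _), integral_const_mul,
            integral_const_mul]
  -- Exact, because `χ` takes only the values 0 and 1: `exp (isχ) = 1 + w χ`.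
  have hexp : ∫ ω, Complex.exp (s * D' ω * Complex.I) ∂μ
      = ∫ ω, e ω ∂μ + w * ∫ ω, χ ω • e ω ∂μ := by
    rw [← integral_const_mul, ← integral_add heint (Integrable.const_mul (f := fun ω => χ ω • e ω) hχe w)]
    refine integral_congr_ae (ae_of_all _ fun ω => ?_)
    have h := hD' ω
    dsimp only
    have hc : (D' ω : ℂ) = ((D' ω : ℝ) : ℂ) := by simp
    rw [hc, h]
    by_cases hω : ω ∈ S
    · simp only [hχ, hω, Set.indicator_of_mem, one_smul, hw, he]
      push_cast
      rw [show (s * (D ω + 1) * Complex.I : ℂ) = s * D ω * Complex.I + s * Complex.I by ring,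
        Complex.exp_add]
      ring
    · simp [hχ, hω, he]
  have hφ : ‖∫ ω, e ω ∂μ‖ ≤ 1 := by
    refine (norm_integral_le_integral_norm _).trans ?_
    simp [henorm]
  have hψ : ‖∫ ω, (D ω : ℝ) • e ω ∂μ‖ ≤ ∫ ω, (D ω : ℝ) ∂μ := by
    refine (norm_integral_le_integral_norm _).trans_eq ?_
    simp [henorm]
  have hqw : ‖(q : ℂ) * w‖ = q * ‖w‖ := by simp [abs_of_nonneg hq]
  have hpoisson : ‖Complex.exp (q * w) - 1 - q * w‖ ≤ |s| * q ^ 2 := by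
    refine (Complex.norm_exp_sub_one_sub_id_le ?_).trans ?_
    · rw [hqw]
      exact mul_le_one₀ hq1 (norm_nonneg _) (hws.trans hs)
    · rw [hqw]
      have := norm_nonneg w
      -- Only one power of `|s|` is kept; it suffices for the total error to vanish as `s → 0`.
      have : ‖w‖ ^ 2 ≤ |s| := by nlinarith
      nlinarith [sq_nonneg q]
  rw [hexp, hpull]
  have hsplit : ∫ ω, e ω ∂μ + w * (q * ∫ ω, e ω ∂μ - (q / T : ℝ) * ∫ ω, (D ω : ℝ) • e ω ∂μ)
      - Complex.exp (q * w) * ∫ ω, e ω ∂μ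
      = -((Complex.exp (q * w) - 1 - q * w) * ∫ ω, e ω ∂μ)
        - w * ((q / T : ℝ) * ∫ ω, (D ω : ℝ) • e ω ∂μ) := by ring
  rw [hsplit]
  refine (norm_sub_le _ _).trans ?_
  rw [norm_neg, norm_mul, norm_mul, norm_mul, Complex.norm_real, Real.norm_of_nonneg (by positivity),
    mul_add]
  refine add_le_add ?_ ?_
  · calc _ ≤ |s| * q ^ 2 * 1 := by gcongr
      _ = _ := mul_one _
  · calc _ ≤ |s| * (q / T * ∫ ω, (D ω : ℝ) ∂μ) := by gcongr
      _ = _ := by ring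

end Step

/-- Telescoping of approximate multiplicative recursions with contracting factors. -/
lemma norm_sub_exp_sum_mul_le {φ : ℕ → ℂ} {a ε : ℕ → ℝ} {w : ℂ} (hw : w.re ≤ 0) {N : ℕ}
    (ha : ∀ n < N, 0 ≤ a n)
    (h : ∀ n < N, ‖φ (n + 1) - Complex.exp (a n * w) * φ n‖ ≤ ε n) :
    ‖φ N - Complex.exp ((∑ n ∈ Finset.range N, a n : ℝ) * w) * φ 0‖
      ≤ ∑ n ∈ Finset.range N, ε n := by
  induction N with
  | zero => simp
  | succ N ih =>
    have ih := ih (fun n hn => ha n (by omega)) (fun n hn => h n (by omega))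
    rw [Finset.sum_range_succ, Finset.sum_range_succ]
    push_cast at ih ⊢
    have hsplit : φ (N + 1) - Complex.exp ((∑ n ∈ Finset.range N, (a n : ℂ) + a N) * w) * φ 0
        = Complex.exp (a N * w)
            * (φ N - Complex.exp ((∑ n ∈ Finset.range N, (a n : ℂ)) * w) * φ 0)
          + (φ (N + 1) - Complex.exp (a N * w) * φ N) := by
      rw [add_mul, Complex.exp_add]
      ring
    have hle : ‖Complex.exp (a N * w)‖ ≤ 1 := by
      rw [Complex.norm_exp, Real.exp_le_one_iff]
      simpa using mul_nonpos_of_nonneg_of_nonpos (ha N (by omega)) hw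
    rw [hsplit]
    refine (norm_add_le _ _).trans (add_le_add ?_ (h N (by omega)))
    rw [norm_mul]
    exact (mul_le_of_le_one_left (norm_nonneg _) hle).trans ih

/-! ### Recursions for the mean and the characteristic function of the degree -/

section CharFun

variable {Ω : Type*} [mΩ : MeasurableSpace Ω] {μ : Measure Ω} {m r : ℕ} {A : ℕ → ℕ → Ω → ℕ}

/-- The expectation of `d_i(n+1, k)`. -/
noncomputable def degMean (μ : Measure Ω) (m r : ℕ) (A : ℕ → ℕ → Ω → ℕ) (i n k : ℕ) : ℝ :=
  ∫ ω, (deg m r (fun l q => A l q ω) i n k : ℝ) ∂μ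

/-- The characteristic function of `d_i(n+1, k)` at `s`. -/
noncomputable def degCharFun (μ : Measure Ω) (m r : ℕ) (A : ℕ → ℕ → Ω → ℕ) (i n k : ℕ) (s : ℝ) :
    ℂ :=
  ∫ ω, Complex.exp (s * (deg m r (fun l q => A l q ω) i n k : ℕ) * Complex.I) ∂μ

lemma degMean_nonneg (i n k : ℕ) : 0 ≤ degMean μ m r A i n k :=
  integral_nonneg fun _ => Nat.cast_nonneg _

lemma degMean_succ_zero {i n : ℕ} (hn : 2 ≤ n) :
    degMean μ m r A i (n + 1) 0 = degMean μ m r A i n m := by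
  simp only [degMean, deg_succ_zero _ hn]

lemma degCharFun_succ_zero {i n : ℕ} (hn : 2 ≤ n) (s : ℝ) :
    degCharFun μ m r A i (n + 1) 0 s = degCharFun μ m r A i n m s := by
  simp only [degCharFun, deg_succ_zero _ hn]

lemma deg_succ_eq_add_indicator {Ω : Type*} (m r : ℕ) (A : ℕ → ℕ → Ω → ℕ) {i n : ℕ} (k : ℕ) (hi : i ≤ n)
    (ω : Ω) :
    (deg m r (fun l q => A l q ω) i n (k + 1) : ℝ) = deg m r (fun l q => A l q ω) i n k
      + (A (n + 1) (k + 1) ⁻¹' {i}).indicator (fun _ => (1 : ℝ)) ω := by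
  rw [deg_succ _ _ hi]
  by_cases h : A (n + 1) (k + 1) ω = i <;> simp [h]

lemma le_attachment_denominator {n m : ℕ} (k : ℕ) (hn : 1 ≤ n) (hm : 1 ≤ m) :
    (n : ℝ) ≤ k + (2 * (n : ℝ) - 1) * m := by
  have h1 : (1 : ℝ) ≤ n := by exact_mod_cast hn
  have h2 : (1 : ℝ) ≤ m := by exact_mod_cast hm
  have h3 : (0 : ℝ) ≤ k := k.cast_nonneg
  nlinarith [mul_nonneg (show (0 : ℝ) ≤ 2 * n - 1 by linarith) (sub_nonneg.2 h2)]

namespace IsLinearDePref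

variable [IsProbabilityMeasure μ] {i n k : ℕ}

lemma degMean_succ_le (hA : IsLinearDePref μ m r A) (hn : 2 ≤ n) (hi : i ∈ Finset.Icc 1 n)
    (hk : k < m) :
    degMean μ m r A i n (k + 1) ≤ degMean μ m r A i n k + 1 / ((n : ℝ) - 1) := by
  have hn' : (2 : ℝ) ≤ n := by exact_mod_cast hn
  have hS := hA.measurable n k hn hk (measurableSet_singleton i)
  rw [degMean, integral_congr_ae (ae_of_all _
    (deg_succ_eq_add_indicator m r A k (Finset.mem_Icc.1 hi).2)),
    integral_add (hA.integrable_deg i hn hk.le) ((integrable_const (1 : ℝ)).indicator hS)]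
  exact add_le_add le_rfl (integral_indicator_le_of_condExp (hA.history_le hn hk.le)
    (hA.integrable_deg i hn hk.le) (one_div_nonneg.2 (by linarith))
    (lt_of_lt_of_le (by linarith) (le_attachment_denominator k (by omega) (by omega)))
    (hA.condProb n k i hn hk hi))

lemma degMean_le (hA : IsLinearDePref μ m r A) (hn : 2 ≤ n) (hi : i ∈ Finset.Icc 1 n)
    (hk : k ≤ m) :
    degMean μ m r A i n k ≤ degMean μ m r A i n 0 + k * (1 / ((n : ℝ) - 1)) := by
  induction k with
  | zero => simp
  | succ k ih =>
    have := hA.degMean_succ_le hn hi (show k < m by omega)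
    have := ih (by omega)
    push_cast
    linarith

lemma norm_degCharFun_succ_sub_le (hA : IsLinearDePref μ m r A) (hn : 2 ≤ n)
    (hi : i ∈ Finset.Icc 1 n) (hk : k < m) {s : ℝ} (hs : |s| ≤ 1) :
    ‖degCharFun μ m r A i n (k + 1) s
        - Complex.exp ((1 / ((n : ℝ) - 1) : ℝ) * (Complex.exp (s * Complex.I) - 1))
          * degCharFun μ m r A i n k s‖
      ≤ |s| * ((1 / ((n : ℝ) - 1)) ^ 2
        + 1 / ((n : ℝ) - 1) * (degMean μ m r A i n 0 + m) / n) := by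
  have hn' : (2 : ℝ) ≤ n := by exact_mod_cast hn
  have hq : 0 ≤ 1 / ((n : ℝ) - 1) := one_div_nonneg.2 (by linarith)
  have hq1 : 1 / ((n : ℝ) - 1) ≤ 1 := by
    rw [div_le_one (by linarith)]
    linarith
  have hT := le_attachment_denominator (n := n) (m := m) k (by omega) (by omega)
  refine (norm_integral_exp_step_le (hA.history_le hn hk.le) (measurable_deg_history m r A i n k)
    (hA.integrable_deg i hn hk.le) (hA.measurable n k hn hk (measurableSet_singleton i)) hq hq1
    (lt_of_lt_of_le (by linarith) hT) (hA.condProb n k i hn hk hi)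
    (deg_succ_eq_add_indicator m r A k (Finset.mem_Icc.1 hi).2) hs).trans ?_
  have hmean : ∫ ω, (deg m r (fun l q => A l q ω) i n k : ℝ) ∂μ ≤ degMean μ m r A i n 0 + m := by
    refine (hA.degMean_le hn hi hk.le).trans (add_le_add le_rfl ?_)
    have hkm : (k : ℝ) ≤ m := by exact_mod_cast hk.le
    exact (mul_le_of_le_one_right k.cast_nonneg hq1).trans hkm
  have h0 := degMean_nonneg (μ := μ) (m := m) (r := r) (A := A) i n 0
  gcongr

lemma norm_degCharFun_succ_zero_sub_le (hA : IsLinearDePref μ m r A) (hn : 2 ≤ n)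
    (hi : i ∈ Finset.Icc 1 n) {s : ℝ} (hs : |s| ≤ 1) :
    ‖degCharFun μ m r A i (n + 1) 0 s
        - Complex.exp ((m * (1 / ((n : ℝ) - 1)) : ℝ) * (Complex.exp (s * Complex.I) - 1))
          * degCharFun μ m r A i n 0 s‖
      ≤ m * (|s| * ((1 / ((n : ℝ) - 1)) ^ 2
        + 1 / ((n : ℝ) - 1) * (degMean μ m r A i n 0 + m) / n)) := by
  have hn' : (2 : ℝ) ≤ n := by exact_mod_cast hn
  have := norm_sub_exp_sum_mul_le (φ := fun k => degCharFun μ m r A i n k s)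
    (re_exp_mul_I_sub_one_nonpos s) (N := m) (a := fun _ => 1 / ((n : ℝ) - 1))
    (fun k _ => one_div_nonneg.2 (by linarith))
    (fun k hk => hA.norm_degCharFun_succ_sub_le hn hi hk hs)
  simp only [Finset.sum_const, Finset.card_range, nsmul_eq_mul] at this
  rwa [degCharFun_succ_zero hn]

/-- The increments `m/(n-1)` give logarithmic growth, but `√n` is enough for summable errors and
makes the induction short: `m/(n-1) ≤ 4m · 1/(2n) ≤ 4m (√(n+1) - √n)`. -/
lemma degMean_le_mul_sqrt (hA : IsLinearDePref μ m r A) {N : ℕ} (hN : 2 ≤ N)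
    (hi : i ∈ Finset.Icc 1 N) :
    ∃ C, 0 ≤ C ∧ ∀ n, N ≤ n → degMean μ m r A i n 0 ≤ C * √n := by
  have h0 := degMean_nonneg (μ := μ) (m := m) (r := r) (A := A) i N 0
  refine ⟨degMean μ m r A i N 0 + 4 * m, by positivity, fun n hn => ?_⟩
  induction n, hn using Nat.le_induction with
  | base =>
    have : 1 ≤ √(N : ℝ) := Real.one_le_sqrt.2 (by exact_mod_cast (by omega : 1 ≤ N))
    nlinarith [(m.cast_nonneg : (0 : ℝ) ≤ m)]
  | succ n hn ih =>
    have hn' : (2 : ℝ) ≤ n := by exact_mod_cast hN.trans hn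
    have hi' : i ∈ Finset.Icc 1 n := by
      simp only [Finset.mem_Icc] at *
      omega
    rw [degMean_succ_zero (hN.trans hn)]
    refine (hA.degMean_le (hN.trans hn) hi' le_rfl).trans ?_
    have h1 : 1 / ((n : ℝ) - 1) ≤ 2 / n := by
      rw [div_le_div_iff₀ (by linarith) (by linarith)]
      linarith
    have h2 : 1 / (2 * n) ≤ √((n : ℝ) + 1) - √n := by
      -- The difference of the roots is `1/(√(n+1) + √n)`, and both roots are at most `n` since `n ≥
      -- 2`.
      have hle : √((n : ℝ) + 1) ≤ n := Real.sqrt_le_iff.2 ⟨by linarith, by nlinarith⟩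
      have hle' : √(n : ℝ) ≤ √((n : ℝ) + 1) := Real.sqrt_le_sqrt (by linarith)
      have hs1 := Real.sq_sqrt (show (0 : ℝ) ≤ n + 1 by linarith)
      have hs2 := Real.sq_sqrt (show (0 : ℝ) ≤ n by linarith)
      rw [div_le_iff₀ (by linarith)]
      nlinarith [mul_nonneg (sub_nonneg.2 hle') (sub_nonneg.2 hle),
        mul_nonneg (sub_nonneg.2 hle') (sub_nonneg.2 (hle'.trans hle))]
    have h3 : (m : ℝ) * (2 / n) = 4 * m * (1 / (2 * n)) := by
      field_simp
      norm_num
    have h4 : (m : ℝ) * (1 / ((n : ℝ) - 1)) ≤ 4 * m * (1 / (2 * n)) := by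
      rw [← h3]
      gcongr
    have h5 : 4 * (m : ℝ) * (1 / (2 * n)) ≤ (degMean μ m r A i N 0 + 4 * m)
        * (√((n : ℝ) + 1) - √n) := by
      gcongr
      linarith
    push_cast
    linarith

end IsLinearDePref

/-! ### Accumulated rates and the uniform Poisson comparison -/

/-- The sum of the attachment rates of a fixed vertex between the times `K + 2` and `K + 2 + j`. -/
lemma sum_attachment_rate_eq (m K j : ℕ) :
    ∑ l ∈ Finset.range j, (m : ℝ) * (1 / (((K + 2 + l : ℕ) : ℝ) - 1))
      = m * ((harmonic (K + j) : ℝ) - harmonic K) := by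
  induction j with
  | zero => simp
  | succ j ih =>
    rw [Finset.sum_range_succ, ih, ← add_assoc, harmonic_succ]
    push_cast
    rw [show (K : ℝ) + 2 + j - 1 = K + j + 1 by ring]
    ring

lemma exists_abs_sum_attachment_rate_sub_log_le (m K : ℕ) :
    ∃ B, ∀ j, |∑ l ∈ Finset.range j, (m : ℝ) * (1 / (((K + 2 + l : ℕ) : ℝ) - 1))
      - m * Real.log ((K + 2 + j : ℕ) : ℝ)| ≤ B := by
  refine ⟨m * (1 + harmonic K), fun j => ?_⟩
  rw [sum_attachment_rate_eq, ← mul_sub, abs_mul, Nat.abs_cast]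
  gcongr
  have hK : (0 : ℝ) ≤ harmonic K := by
    rcases Nat.eq_zero_or_pos K with rfl | h
    · simp
    · exact_mod_cast (harmonic_pos (by omega)).le
  have h1 := harmonic_le_one_add_log (K + j)
  have h2 := log_add_one_le_harmonic (K + j)
  have hlog : Real.log ((K + j : ℕ) : ℝ) ≤ Real.log ((K + 2 + j : ℕ) : ℝ) := by
    -- For `K + j = 0` the convention `Real.log 0 = 0` applies.
    rcases Nat.eq_zero_or_pos (K + j) with h | h
    · rw [h, Nat.cast_zero, Real.log_zero]
      exact Real.log_natCast_nonneg _
    · exact Real.log_le_log (by exact_mod_cast h) (by exact_mod_cast (by omega))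
  have hlog' : Real.log ((K + 2 + j : ℕ) : ℝ) ≤ Real.log ((K + j + 1 : ℕ) : ℝ) + 1 := by
    have hle : ((K + 2 + j : ℕ) : ℝ) ≤ ((K + j + 1 : ℕ) : ℝ) * 2 := by
      exact_mod_cast (by omega)
    have := Real.log_le_log (by positivity) hle
    rw [Real.log_mul (by positivity) (by norm_num)] at this
    linarith [Real.log_two_lt_d9]
  rw [abs_le]
  constructor <;> linarith

namespace IsLinearDePref

variable [IsProbabilityMeasure μ] {i : ℕ}

/-- Uniformly in time, the characteristic function of the degree of a vertex is close, near the
origin, to that of an independent sum of a degree at a fixed time and a Poisson variable. -/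
lemma exists_norm_degCharFun_sub_le (hA : IsLinearDePref μ m r A) {K : ℕ}
    (hi : i ∈ Finset.Icc 1 (K + 2)) :
    ∃ C, ∀ (j : ℕ) (s : ℝ), |s| ≤ 1 → ‖degCharFun μ m r A i (K + 2 + j) 0 s
        - Complex.exp ((∑ l ∈ Finset.range j, (m : ℝ) * (1 / (((K + 2 + l : ℕ) : ℝ) - 1)) : ℝ)
          * (Complex.exp (s * Complex.I) - 1)) * degCharFun μ m r A i (K + 2) 0 s‖ ≤ C * |s| := by
  obtain ⟨C, hC, hmean⟩ := hA.degMean_le_mul_sqrt (by omega) hi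
  have hsum : Summable fun l : ℕ => 1 / ((K + 2 + l : ℕ) : ℝ) ^ (3 / 2 : ℝ) := by
    have := (summable_nat_add_iff (K + 2)).2
      (Real.summable_one_div_nat_rpow (p := 3 / 2) |>.2 (by norm_num))
    simpa only [add_comm] using this
  -- With `x = K + 2 + l` and `1/(x-1) ≤ 2/x`, the squared rate contributes 4 and the feedback term
  -- `2 (C + m)`, each times `x^{-3/2}`.
  set E : ℝ := m * (4 + 2 * (C + m)) with hE
  refine ⟨E * ∑' l : ℕ, 1 / ((K + 2 + l : ℕ) : ℝ) ^ (3 / 2 : ℝ), fun j s hs => ?_⟩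
  refine (norm_sub_exp_sum_mul_le (φ := fun j => degCharFun μ m r A i (K + 2 + j) 0 s)
    (a := fun l => (m : ℝ) * (1 / (((K + 2 + l : ℕ) : ℝ) - 1)))
    (ε := fun l => |s| * E * (1 / ((K + 2 + l : ℕ) : ℝ) ^ (3 / 2 : ℝ)))
    (re_exp_mul_I_sub_one_nonpos s) (fun l _ => ?_) fun l _ => ?_).trans ?_
  · refine mul_nonneg m.cast_nonneg (one_div_nonneg.2 ?_)
    push_cast
    linarith [(K.cast_nonneg : (0 : ℝ) ≤ K), (l.cast_nonneg : (0 : ℝ) ≤ l)]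
  · have hi' : i ∈ Finset.Icc 1 (K + 2 + l) := by
      simp only [Finset.mem_Icc] at *
      omega
    refine (hA.norm_degCharFun_succ_zero_sub_le (by omega) hi' hs).trans ?_
    have hM := hmean (K + 2 + l) (by omega)
    have hx2 : 2 ≤ ((K + 2 + l : ℕ) : ℝ) := by exact_mod_cast (by omega)
    set x : ℝ := ((K + 2 + l : ℕ) : ℝ)
    have hx0 : 0 < x := by linarith
    have hsq := Real.sq_sqrt hx0.le
    have hsx1 : 1 ≤ √x := Real.one_le_sqrt.2 (by linarith)
    have hpow : x ^ (3 / 2 : ℝ) = x * √x := by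
      rw [Real.sqrt_eq_rpow, ← Real.rpow_one_add' hx0.le (by norm_num)]
      norm_num
    have hq : 1 / (x - 1) ≤ 2 / x := by
      rw [div_le_div_iff₀ (by linarith) hx0]
      linarith
    have hq0 : 0 ≤ 1 / (x - 1) := one_div_nonneg.2 (by linarith)
    have h0 := degMean_nonneg (μ := μ) (m := m) (r := r) (A := A) i (K + 2 + l) 0
    have h1 : (1 / (x - 1)) ^ 2 ≤ 4 * (1 / (x * √x)) := by
      calc (1 / (x - 1)) ^ 2 ≤ (2 / x) ^ 2 := by gcongr
        _ = 4 * (1 / (x * x)) := by ring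
        _ ≤ _ := by
          gcongr
          nlinarith
    have h2 : 1 / (x - 1) * (degMean μ m r A i (K + 2 + l) 0 + m) / x
        ≤ 2 * (C + m) * (1 / (x * √x)) := by
      calc _ ≤ 2 / x * (C * √x + m * √x) / x := by
            gcongr
            exact le_mul_of_one_le_right m.cast_nonneg hsx1
        _ = 2 * (C + m) * (√x / (x * x)) := by ring
        _ = 2 * (C + m) * (1 / (x * √x)) := by
            congr 1
            rw [div_eq_div_iff (by positivity) (by positivity)]
            linear_combination x * hsq
    rw [hpow]
    calc _ ≤ m * (|s| * (4 * (1 / (x * √x)) + 2 * (C + m) * (1 / (x * √x)))) := by gcongr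
      _ = _ := by
        rw [hE]
        ring
  · rw [← Finset.mul_sum]
    have hle := hsum.sum_le_tsum (Finset.range j) fun l _ => by positivity
    have hE0 : 0 ≤ E := by positivity
    calc _ ≤ |s| * E * ∑' l : ℕ, 1 / ((K + 2 + l : ℕ) : ℝ) ^ (3 / 2 : ℝ) := by gcongr
      _ = _ := by ring

end IsLinearDePref

end CharFun

/-! ### Normal limit of the standardized Poisson law -/

lemma norm_exp_mul_I_sub_one_sub_le {s : ℝ} (hs : |s| ≤ 1) :
    ‖Complex.exp (s * Complex.I) - 1 - s * Complex.I + s ^ 2 / 2‖ ≤ |s| ^ 3 := by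
  have hnorm : ‖(s : ℂ) * Complex.I‖ = |s| := by simp
  have h := Complex.exp_bound (x := s * Complex.I) (hnorm.trans_le hs) (n := 3) (by norm_num)
  have heq : Complex.exp (s * Complex.I) - 1 - s * Complex.I + s ^ 2 / 2
      = Complex.exp (s * Complex.I)
        - ∑ k ∈ Finset.range 3, (s * Complex.I) ^ k / (k.factorial : ℂ) := by
    simp only [Finset.sum_range_succ, Finset.sum_range_zero, mul_pow, Complex.I_sq,
      Nat.factorial]
    push_cast
    ring
  rw [heq]
  refine h.trans ?_
  rw [hnorm]
  exact mul_le_of_le_one_right (by positivity) (by norm_num [Nat.factorial])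

/-- A Poisson variable whose parameter is at bounded distance from `v`, centred at `v` and divided
by `√v`, converges to a standard normal variable as `v → ∞`, in terms of characteristic
functions. -/
lemma tendsto_exp_poisson_standardized {Λ v : ℕ → ℝ} {B : ℝ} (hv : Tendsto v atTop atTop)
    (hB : ∀ n, |Λ n - v n| ≤ B) (t : ℝ) :
    Tendsto (fun n => Complex.exp (Λ n * (Complex.exp ((t / √(v n) : ℝ) * Complex.I) - 1)
      - (t / √(v n) : ℝ) * v n * Complex.I)) atTop (nhds (Complex.exp (-t ^ 2 / 2))) := by
  refine (Complex.continuous_exp.tendsto _).comp (tendsto_iff_norm_sub_tendsto_zero.2 ?_)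
  have hs : Tendsto (fun n => |t / √(v n)|) atTop (nhds 0) := by
    simpa using (tendsto_const_nhds.div_atTop (Real.tendsto_sqrt_atTop.comp hv)).abs
      (f := fun n => t / √(v n))
  have hlim : Tendsto (fun n => (t ^ 2 + B) * |t / √(v n)|) atTop (nhds 0) := by
    simpa using hs.const_mul (t ^ 2 + B)
  refine squeeze_zero' (Eventually.of_forall fun n => norm_nonneg _) ?_ hlim
  filter_upwards [hs.eventually_le_const one_pos, hv.eventually_gt_atTop 0] with n hs1 hv0
  have hsq : (t / √(v n)) ^ 2 * v n = t ^ 2 := by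
    rw [div_pow, Real.sq_sqrt hv0.le, div_mul_cancel₀ _ hv0.ne']
  generalize t / √(v n) = s at hs1 hsq
  -- Since `s² v = t²`, the Taylor remainder costs `v |s|³ = t² |s|`, and the bounded error in the
  -- parameter costs `B |s|`.
  have hsplit : (Λ n : ℂ) * (Complex.exp (s * Complex.I) - 1) - s * v n * Complex.I
        - -(t : ℂ) ^ 2 / 2
      = (v n : ℂ) * (Complex.exp (s * Complex.I) - 1 - s * Complex.I + s ^ 2 / 2)
        + (Λ n - v n : ℝ) * (Complex.exp (s * Complex.I) - 1) := by
    have : (t : ℂ) ^ 2 = s ^ 2 * v n := by exact_mod_cast hsq.symm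
    rw [this]
    push_cast
    ring
  have hw := norm_exp_mul_I_sub_one_le s
  rw [hsplit]
  calc _ ≤ v n * |s| ^ 3 + B * |s| := by
        refine (norm_add_le _ _).trans (add_le_add ?_ ?_)
        · rw [norm_mul, Complex.norm_real, Real.norm_of_nonneg hv0.le]
          gcongr
          exact norm_exp_mul_I_sub_one_sub_le hs1
        · rw [norm_mul, Complex.norm_real, Real.norm_eq_abs]
          gcongr
          · exact (abs_nonneg _).trans (hB n)
          · exact hB n
    _ = _ := by
        rw [← hsq, ← sq_abs s]
        ring

/-! ### Limit of the standardized characteristic function -/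

namespace IsLinearDePref

variable {Ω : Type*} [mΩ : MeasurableSpace Ω] {μ : Measure Ω} {m r : ℕ} {A : ℕ → ℕ → Ω → ℕ}
  [IsProbabilityMeasure μ] {i : ℕ}

lemma tendsto_degCharFun_zero (hA : IsLinearDePref μ m r A) (i n : ℕ) :
    Tendsto (degCharFun μ m r A i n 0) (nhds 0) (nhds 1) := by
  have hmeas : Measurable fun ω => (deg m r (fun l q => A l q ω) i n 0 : ℝ) :=
    measurable_from_nat.comp (hA.measurable_deg_zero i n)
  have heq : degCharFun μ m r A i n 0
      = charFun (μ.map fun ω => (deg m r (fun l q => A l q ω) i n 0 : ℝ)) := by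
    funext s
    rw [charFun_apply_real, integral_map hmeas.aemeasurable (by fun_prop)]
    simp [degCharFun]
  have := Measure.isProbabilityMeasure_map (μ := μ) hmeas.aemeasurable
  simpa [heq] using (continuous_charFun
    (μ := μ.map fun ω => (deg m r (fun l q => A l q ω) i n 0 : ℝ))).tendsto 0

lemma tendsto_charFun_standardized (hA : IsLinearDePref μ m r A) (hm : 1 ≤ m) (hi : 1 ≤ i)
    (t : ℝ) :
    Tendsto (fun n : ℕ => Complex.exp (-((t / √(m * Real.log n) : ℝ) * (m * Real.log n : ℝ)
        * Complex.I)) * degCharFun μ m r A i n 0 (t / √(m * Real.log n)))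
      atTop (nhds (Complex.exp (-t ^ 2 / 2))) := by
  -- Starting time `i + 2`: the vertex `i` is present and the recursion, valid from time 2 on,
  -- applies.
  have hiK : i ∈ Finset.Icc 1 (i + 2) := Finset.mem_Icc.2 ⟨hi, by omega⟩
  obtain ⟨C, hC⟩ := hA.exists_norm_degCharFun_sub_le hiK
  obtain ⟨B, hB⟩ := exists_abs_sum_attachment_rate_sub_log_le m i
  refine (tendsto_add_atTop_iff_nat (i + 2)).1 ?_
  simp only [add_comm _ (i + 2)]
  set v : ℕ → ℝ := fun j => m * Real.log ((i + 2 + j : ℕ) : ℝ) with hvdef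
  set s : ℕ → ℝ := fun j => t / √(v j) with hsdef
  set Λ : ℕ → ℝ := fun j =>
    ∑ l ∈ Finset.range j, (m : ℝ) * (1 / (((i + 2 + l : ℕ) : ℝ) - 1))
  have hv : Tendsto v atTop atTop := by
    refine Tendsto.const_mul_atTop (by exact_mod_cast hm) (Real.tendsto_log_atTop.comp
      (tendsto_natCast_atTop_atTop.comp ?_))
    exact tendsto_atTop_mono (fun j => Nat.le_add_left j (i + 2)) tendsto_id
  have hs : Tendsto s atTop (nhds 0) :=
    tendsto_const_nhds.div_atTop (Real.tendsto_sqrt_atTop.comp hv)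
  have hmain := (tendsto_exp_poisson_standardized hv hB t).mul
    ((hA.tendsto_degCharFun_zero i (i + 2)).comp hs)
  rw [mul_one] at hmain
  refine tendsto_of_tendsto_of_dist hmain ?_
  have hlim : Tendsto (fun j => C * |s j|) atTop (nhds 0) := by simpa using hs.abs.const_mul C
  refine squeeze_zero' (Eventually.of_forall fun _ => dist_nonneg) ?_ hlim
  have hs1 : ∀ᶠ j in atTop, |s j| ≤ 1 := by
    have : Tendsto (fun j => |s j|) atTop (nhds 0) := by simpa using hs.abs
    exact this.eventually_le_const one_pos
  filter_upwards [hs1] with j hj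
  -- The centring factor has modulus 1, so it does not enlarge the error `C |s|`.
  have hone : ‖Complex.exp (-((s j : ℂ) * (v j : ℝ) * Complex.I))‖ = 1 := by
    have := Complex.norm_exp_ofReal_mul_I (-(s j * v j))
    push_cast at this
    rwa [neg_mul] at this
  rw [dist_comm, dist_eq_norm]
  change ‖Complex.exp (-((s j : ℂ) * (v j : ℝ) * Complex.I))
      * degCharFun μ m r A i (i + 2 + j) 0 (s j)
    - Complex.exp (Λ j * (Complex.exp (s j * Complex.I) - 1) - s j * v j * Complex.I)
      * degCharFun μ m r A i (i + 2) 0 (s j)‖ ≤ _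
  rw [sub_eq_neg_add (_ * _) (_ * Complex.I), Complex.exp_add, mul_assoc (Complex.exp _), ← mul_sub, norm_mul,
    hone, one_mul]
  exact hC j (s j) hj

end IsLinearDePref

end DePref

theorem theorem2p6 {Ω : Type*} [MeasurableSpace Ω] (μ : Measure Ω) [IsProbabilityMeasure μ]
    (m r : ℕ) (hm : 1 ≤ m) (hr : r = 1 ∨ r = 2) (A : ℕ → ℕ → Ω → ℕ)
    (hA : DePref.IsLinearDePref μ m r A) (i : ℕ) (hi : 1 ≤ i) :
    TendstoInDistribution
      (fun (n : ℕ) (ω : Ω) =>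
        ((DePref.deg m r (fun l q => A l q ω) i n 0 : ℝ) - (m : ℝ) * Real.log (n : ℝ))
          / Real.sqrt ((m : ℝ) * Real.log (n : ℝ)))
      atTop (id : ℝ → ℝ) (fun _ => μ) (gaussianReal 0 1) := by
  have hmeas : ∀ n : ℕ, Measurable fun ω : Ω =>
      ((DePref.deg m r (fun l q => A l q ω) i n 0 : ℝ) - (m : ℝ) * Real.log (n : ℝ))
        / Real.sqrt ((m : ℝ) * Real.log (n : ℝ)) := fun n =>
    ((measurable_from_nat.comp (hA.measurable_deg_zero i n)).sub_const _).div_const _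
  refine ⟨fun n => (hmeas n).aemeasurable, aemeasurable_id, ?_⟩
  refine ProbabilityMeasure.tendsto_iff_tendsto_charFun.2 fun t => ?_
  simp only [ProbabilityMeasure.coe_mk, Measure.map_id]
  convert! hA.tendsto_charFun_standardized hm hi t using 2 with n
  · rw [charFun_apply_real, integral_map (hmeas n).aemeasurable (by fun_prop),
      DePref.degCharFun, ← integral_const_mul]
    congr 1 with ω
    rw [← Complex.exp_add]
    congr 1
    push_cast
    ring
  · rw [charFun_gaussianReal]
    congr 1
    simp
    ring
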